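/- Work in the 2-category \(\mathbf{2Hilb}\) in its matrix presentation. Objects are \(\mathbf{Hilb}^n\), \(n\in\mathbb N\). A 1-cell \(\mathbf{Hilb}^n\to\mathbf{Hilb}^m\) is an \(m\times n\) matrix of finite-dimensional complex Hilbert spaces, composed by matrix multiplication with \(\oplus\) and \(\otimes\). A 2-cell is a matrix of linear maps, composed vertically entry by entry and horizontally through \(\otimes\) and \(\oplus\). The reversal \(\dagger\) of a 2-cell takes the adjoint of every entry, and a 2-cell \(u\) is unitary if \(u^\dagger\) is its inverse. The unit object is \(I=\mathbf{Hilb}\). The 1-cells \(I\to I\) form a symmetric monoidal category under composition, whose symmetry is the flip of the tensor product of Hilbert spaces. A witness for an object \(A\) consists of 1-cells \(L:I\to A\) and \(R:A\to I\) and 2-cells \[\mathrm{create}:\mathrm{id}_I\Rightarrow R\circ L,\quad \mathrm{delete}:R\circ L\Rightarrow \mathrm{id}_I,\quad \mathrm{copy}:\mathrm{id}_A\Rightarrow L\circ R,\quad \mathrm{compare}:L\circ R\Rightarrow \mathrm{id}_A\] such that (i) (reversal) \(\mathrm{delete}=\mathrm{create}^\dagger\) and \(\mathrm{compare}=\mathrm{copy}^\dagger\);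 (ii) (ambidextrous duality) create and compare satisfy the two triangle (straightening) equations, and so do copy and delete; (iii) (copy–compare) \(\mathrm{compare}\cdot\mathrm{copy}=\mathrm{id}\); (iv) (commutativity) the multiplication \((R\circ L)\circ(R\circ L)\Rightarrow R\circ L\) obtained by applying compare to the two inner 1-cells is unchanged when it is preceded by the symmetry exchanging the two copies of \(R\circ L\). A unitary isomorphism of witnesses is a pair of unitary 2-cells \(L\Rightarrow L'\), \(R\Rightarrow R'\) that carries create, delete, copy and compare of the first witness to those of the second. **Theorem.** Let \(n\in\mathbb N\). 1. There is a witness for \(\mathbf{Hilb}^n\) whose 1-cells are the column \((\mathbb C,\dots,\mathbb C)^{T}:\mathbf{Hilb}\to\mathbf{Hilb}^n\) and the row \((\mathbb C,\dots,\mathbb C):\mathbf{Hilb}^n\to\mathbf{Hilb}\), and whose 2-cells are, with \(\mathbb C\otimes\mathbb C=\mathbb C\): copy and compare are the \(n\times n\) matrices of linear maps with the map \(1:\mathbb C\to\mathbb C\) in every diagonal entry and the zero map (out of, respectively into, the zero space) in every other entry; create is the all-ones column \(\mathbb C\to\mathbb C^n\); and delete is the all-ones row \(\mathbb C^n\to\mathbb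 C\). 2. Every witness for \(\mathbf{Hilb}^n\) is unitarily isomorphic to this one. 3. If 1-cells and 2-cells of the above types for \(\mathbf{Hilb}^n\) satisfy (ii) and (iv), then every entry of \(L\) and of \(R\) has dimension at most 1; in every witness, every entry of \(L\) and of \(R\) has dimension exactly 1. 4. If 1-cells and 2-cells of the above types for \(\mathbf{Hilb}^n\) satisfy (i) and (iii), and \(i\) is an index for which \(L_i\) and \(R_i\) are 1-dimensional, then for all unit vectors \(x\in L_i\), \(y\in R_i\), the scalar \(\mathrm{compare}_{ii}(x\otimes y)\in\mathbb C\) has absolute value 1. By part 3, this applies to every index of every witness. -/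

import Mathlib

open CategoryTheory
open scoped TensorProduct Bicategory

/-! ### Finite-dimensional Hilbert spaces -/

/-- A finite-dimensional complex Hilbert space. -/
structure FdHilb where
  carrier : Type
  [normed : NormedAddCommGroup carrier]
  [inner : InnerProductSpace ℂ carrier]
  [finite : FiniteDimensional ℂ carrier]

namespace FdHilb

instance : CoeSort FdHilb Type := ⟨FdHilb.carrier⟩

attribute [instance] FdHilb.normed FdHilb.inner FdHilb.finite

/-- The one-dimensional Hilbert space `ℂ`. -/
noncomputable def complex : FdHilb := ⟨ℂ⟩

/-- The number `1`, the standard basis vector of the Hilbert space `ℂ`. -/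
noncomputable def complexOne : complex := (1 : ℂ)

/-- An element of the Hilbert space `ℂ` as a complex number. -/
noncomputable def toComplex : complex →ₗ[ℂ] ℂ := (LinearMap.id : ℂ →ₗ[ℂ] ℂ)

@[simp] theorem toComplex_one : toComplex complexOne = 1 := rfl

theorem toComplex_smul_one (z : complex) : toComplex z • complexOne = z := mul_one (M := ℂ) z

theorem complex_ext {M : Type*} [AddCommMonoid M] [Module ℂ M] {f g : complex →ₗ[ℂ] M}
    (h : f complexOne = g complexOne) : f = g :=
  LinearMap.ext fun z => by rw [← toComplex_smul_one z, map_smul, map_smul, h]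

/-! #### Tensor products -/

section tensor

variable {X Y Z X' Y' : FdHilb}

/-- The tensor product of two Hilbert spaces, with Mathlib's inner product
`⟪a ⊗ b, c ⊗ d⟫ = ⟪a, c⟫ ⟪b, d⟫`. -/
noncomputable def tensor (X Y : FdHilb) : FdHilb := ⟨X ⊗[ℂ] Y⟩

/-- The elementary tensor `x ⊗ y`. -/
noncomputable def tmul : X →ₗ[ℂ] Y →ₗ[ℂ] tensor X Y := TensorProduct.mk ℂ X Y

/-- The linear map out of a tensor product given by a bilinear map. -/
noncomputable def tlift (f : X →ₗ[ℂ] Y →ₗ[ℂ] Z) : tensor X Y →ₗ[ℂ] Z := TensorProduct.lift f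

@[simp] theorem tlift_tmul (f : X →ₗ[ℂ] Y →ₗ[ℂ] Z) (x : X) (y : Y) :
    tlift f (tmul x y) = f x y := TensorProduct.lift.tmul x y

theorem tensor_ext {M : Type*} [AddCommMonoid M] [Module ℂ M] {f g : tensor X Y →ₗ[ℂ] M}
    (h : ∀ x, f ∘ₗ tmul x = g ∘ₗ tmul x) : f = g :=
  TensorProduct.ext (M := X) (N := Y) (g := f) (h := g) (LinearMap.ext h)

/-- The tensor product of two linear maps. -/
noncomputable def tmap (f : X →ₗ[ℂ] X') (g : Y →ₗ[ℂ] Y') : tensor X Y →ₗ[ℂ] tensor X' Y' :=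
  TensorProduct.map f g

@[simp] theorem tmap_tmul (f : X →ₗ[ℂ] X') (g : Y →ₗ[ℂ] Y') (x : X) (y : Y) :
    tmap f g (tmul x y) = tmul (f x) (g y) := rfl

/-- The symmetry `x ⊗ y ↦ y ⊗ x`. -/
noncomputable def tswap (X Y : FdHilb) : tensor X Y →ₗ[ℂ] tensor Y X :=
  (TensorProduct.comm ℂ X Y).toLinearMap

@[simp] theorem tswap_tmul (x : X) (y : Y) : tswap X Y (tmul x y) = tmul y x := rfl

/-- Reassociation `(x ⊗ y) ⊗ z ↦ x ⊗ (y ⊗ z)`. -/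
noncomputable def tassoc (X Y Z : FdHilb) :
    tensor (tensor X Y) Z →ₗ[ℂ] tensor X (tensor Y Z) :=
  (TensorProduct.assoc ℂ X Y Z).toLinearMap

@[simp] theorem tassoc_tmul (x : X) (y : Y) (z : Z) :
    tassoc X Y Z (tmul (tmul x y) z) = tmul x (tmul y z) := rfl

/-- Reassociation `x ⊗ (y ⊗ z) ↦ (x ⊗ y) ⊗ z`. -/
noncomputable def tassocInv (X Y Z : FdHilb) :
    tensor X (tensor Y Z) →ₗ[ℂ] tensor (tensor X Y) Z :=
  (TensorProduct.assoc ℂ X Y Z).symm.toLinearMap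

@[simp] theorem tassocInv_tmul (x : X) (y : Y) (z : Z) :
    tassocInv X Y Z (tmul x (tmul y z)) = tmul (tmul x y) z := rfl

end tensor

/-! #### Direct sums -/

section dsum

variable {ι : Type} [Fintype ι] {X : ι → FdHilb} {Y Z : FdHilb}

/-- The orthogonal direct sum of a finite family of Hilbert spaces. -/
noncomputable def dsum (X : ι → FdHilb) : FdHilb := ⟨PiLp 2 fun k => X k⟩

/-- The projection of a direct sum onto a summand. -/
noncomputable def proj (k : ι) : dsum X →ₗ[ℂ] X k :=
  LinearMap.proj k ∘ₗ (WithLp.linearEquiv 2 ℂ (∀ k, X k)).toLinearMap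

/-- The map out of a direct sum with given restrictions to the summands. -/
noncomputable def desc (f : ∀ k, X k →ₗ[ℂ] Y) : dsum X →ₗ[ℂ] Y := ∑ k, f k ∘ₗ proj k

/-- The map out of `Z ⊗ (⨁ₖ X k)` with given restrictions to the `Z ⊗ X k`. -/
noncomputable def descLeft (f : ∀ k, tensor Z (X k) →ₗ[ℂ] Y) : tensor Z (dsum X) →ₗ[ℂ] Y :=
  ∑ k, f k ∘ₗ tmap LinearMap.id (proj k)

/-- The map out of `(⨁ₖ X k) ⊗ Z` with given restrictions to the `X k ⊗ Z`. -/
noncomputable def descRight (f : ∀ k, tensor (X k) Z →ₗ[ℂ] Y) : tensor (dsum X) Z →ₗ[ℂ] Y :=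
  ∑ k, f k ∘ₗ tmap (proj k) LinearMap.id

variable [DecidableEq ι]

/-- The inclusion of a summand into a direct sum. -/
noncomputable def incl (k : ι) : X k →ₗ[ℂ] dsum X :=
  (WithLp.linearEquiv 2 ℂ (∀ k, X k)).symm.toLinearMap ∘ₗ LinearMap.single ℂ (fun k => X k) k

@[simp] theorem proj_incl_same (k : ι) (x : X k) : proj k (incl k x) = x :=
  Pi.single_eq_same (M := fun k => X k) k x

theorem proj_incl_ne {k l : ι} (h : l ≠ k) (x : X k) : proj l (incl k x) = 0 :=
  Pi.single_eq_of_ne (M := fun k => X k) h x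

theorem dsum_ext {M : Type*} [AddCommMonoid M] [Module ℂ M] {f g : dsum X →ₗ[ℂ] M}
    (h : ∀ k, f ∘ₗ incl k = g ∘ₗ incl k) : f = g := by
  have key : f ∘ₗ (WithLp.linearEquiv 2 ℂ (∀ k, X k)).symm.toLinearMap =
      g ∘ₗ (WithLp.linearEquiv 2 ℂ (∀ k, X k)).symm.toLinearMap :=
    LinearMap.pi_ext' h
  exact LinearMap.ext fun x => LinearMap.congr_fun key (WithLp.linearEquiv 2 ℂ (∀ k, X k) x)

@[simp] theorem desc_incl (f : ∀ k, X k →ₗ[ℂ] Y) (k : ι) (x : X k) :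
    desc f (incl k x) = f k x := by
  rw [desc, LinearMap.sum_apply, Finset.sum_eq_single k]
  · simp
  · intro l _ h; simp [proj_incl_ne h]
  · simp

@[simp] theorem descLeft_incl (f : ∀ k, tensor Z (X k) →ₗ[ℂ] Y) (k : ι) (z : Z) (x : X k) :
    descLeft f (tmul z (incl k x)) = f k (tmul z x) := by
  rw [descLeft, LinearMap.sum_apply, Finset.sum_eq_single k]
  · simp
  · intro l _ h; simp [proj_incl_ne h]
  · simp

@[simp] theorem descRight_incl (f : ∀ k, tensor (X k) Z →ₗ[ℂ] Y) (k : ι) (z : Z) (x : X k) :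
    descRight f (tmul (incl k x) z) = f k (tmul x z) := by
  rw [descRight, LinearMap.sum_apply, Finset.sum_eq_single k]
  · simp
  · intro l _ h; simp [proj_incl_ne h]
  · simp

end dsum

/-! #### Entries of identity matrices -/

section delta

variable {n : ℕ} {i j : Fin n}

/-- The `(i, j)` entry of an identity matrix: the Hilbert space with orthonormal basis the
proofs of `i = j`, which is a copy of `ℂ` on the diagonal and the zero space off it. -/
noncomputable def delta (i j : Fin n) : FdHilb := dsum fun _ : PLift (i = j) => complex

/-- The basis vector `1` of a diagonal entry of an identity matrix. -/
noncomputable def one (h : i = j) : delta i j :=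
  incl (X := fun _ : PLift (i = j) => complex) ⟨h⟩ complexOne

/-- The identification of a diagonal entry of an identity matrix with `ℂ`. -/
noncomputable def coord (h : i = j) : delta i j →ₗ[ℂ] ℂ :=
  toComplex ∘ₗ proj (X := fun _ : PLift (i = j) => complex) ⟨h⟩

@[simp] theorem coord_one (h : i = j) : coord h (one h) = 1 :=
  congrArg toComplex (proj_incl_same (X := fun _ : PLift (i = j) => complex) ⟨h⟩ complexOne)

theorem delta_ext {M : Type*} [AddCommMonoid M] [Module ℂ M] {f g : delta i j →ₗ[ℂ] M}
    (h : ∀ p, f (one p) = g (one p)) : f = g :=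
  dsum_ext fun p => complex_ext (h p.down)

end delta

end FdHilb

open FdHilb

/-! ### The 2-category `2Hilb` in the matrix calculus -/

/-- The object `Hilb^n` of `2Hilb`, the `n`-fold product of the category of finite-dimensional
Hilbert spaces. -/
structure TwoHilb where
  dim : ℕ

namespace TwoHilb

/-- A 1-cell `Hilb^n ⟶ Hilb^m`: an `m × n` matrix of finite-dimensional Hilbert spaces. -/
structure OneCell (a b : TwoHilb) where
  entry : Fin b.dim → Fin a.dim → FdHilb

/-- A 2-cell: a matrix of linear maps (automatically bounded). -/
@[ext] structure TwoCell {a b : TwoHilb} (F G : OneCell a b) where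
  app : ∀ i j, F.entry i j →ₗ[ℂ] G.entry i j

/-- Composition of 1-cells is matrix multiplication, in the order of composition of functors:
`(F ≫ G) i j = ⨁ₖ G i k ⊗ F k j`. -/
noncomputable instance : CategoryStruct TwoHilb where
  Hom := OneCell
  id _ := ⟨fun i j => delta i j⟩
  comp F G := ⟨fun i j => dsum fun k => tensor (G.entry i k) (F.entry k j)⟩

/-- Vertical composition of 2-cells is entrywise. -/
instance (a b : TwoHilb) : Category (a ⟶ b) where
  Hom F G := TwoCell F G
  id _ := ⟨fun _ _ => LinearMap.id⟩
  comp η θ := ⟨fun i j => θ.app i j ∘ₗ η.app i j⟩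

section

variable {a b c d : TwoHilb}

theorem hom_ext {F G : a ⟶ b} {η θ : F ⟶ G} (h : ∀ i j, η.app i j = θ.app i j) : η = θ :=
  TwoCell.ext (funext fun i => funext fun j => h i j)

@[simp] theorem id_app (F : a ⟶ b) (i) (j) : TwoCell.app (𝟙 F) i j = LinearMap.id := rfl

@[simp] theorem comp_app {F G H : a ⟶ b} (η : F ⟶ G) (θ : G ⟶ H) (i) (j) :
    (η ≫ θ).app i j = θ.app i j ∘ₗ η.app i j := rfl

/-- The elementary tensor `y ⊗ x` in the `k`-th summand of the entry `(i, j)` of a composite. -/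
noncomputable def gen (F : a ⟶ b) (G : b ⟶ c) {i j} (k) :
    G.entry i k →ₗ[ℂ] F.entry k j →ₗ[ℂ] (F ≫ G).entry i j :=
  (LinearMap.llcomp ℂ (F.entry k j) _ _
    (incl (X := fun k => tensor (G.entry i k) (F.entry k j)) k)) ∘ₗ tmul

/-- The number `1` in a diagonal entry of an identity 1-cell. -/
noncomputable def unitVec (a : TwoHilb) (i) : OneCell.entry (𝟙 a) i i := one rfl

/-- The linear map out of an entry of a composite with given values on elementary tensors. -/
noncomputable def descGen {F : a ⟶ b} {G : b ⟶ c} {i j} {Y : FdHilb}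
    (f : ∀ k, G.entry i k →ₗ[ℂ] F.entry k j →ₗ[ℂ] Y) : (F ≫ G).entry i j →ₗ[ℂ] Y :=
  desc fun k => tlift (f k)

@[simp] theorem descGen_gen {F : a ⟶ b} {G : b ⟶ c} {i j} {Y : FdHilb}
    (f : ∀ k, G.entry i k →ₗ[ℂ] F.entry k j →ₗ[ℂ] Y) (k) (y : G.entry i k) (x : F.entry k j) :
    descGen f (gen F G k y x) = f k y x :=
  (desc_incl (X := fun k => tensor (G.entry i k) (F.entry k j)) _ k _).trans (tlift_tmul _ _ _)

section ext

variable {M : Type*} [AddCommMonoid M] [Module ℂ M]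

theorem ext_gen {F : a ⟶ b} {G : b ⟶ c} {i j} {f g : (F ≫ G).entry i j →ₗ[ℂ] M}
    (h : ∀ k y, f ∘ₗ gen F G k y = g ∘ₗ gen F G k y) : f = g :=
  dsum_ext (X := fun k => tensor (G.entry i k) (F.entry k j)) fun k => tensor_ext fun y => h k y

theorem ext_gen' {F : a ⟶ b} {G : b ⟶ c} {i j} {f g : (F ≫ G).entry i j →ₗ[ℂ] M}
    (h : ∀ k x, f ∘ₗ (gen F G k).flip x = g ∘ₗ (gen F G k).flip x) : f = g :=
  ext_gen fun k y => LinearMap.ext fun x => LinearMap.congr_fun (h k x) y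

theorem ext_unit {i j} {f g : OneCell.entry (𝟙 a) i j →ₗ[ℂ] M}
    (h : ∀ p : i = j, f (p ▸ unitVec a i) = g (p ▸ unitVec a i)) : f = g :=
  delta_ext fun p => by subst p; exact h rfl

theorem ext_unit_right {F : a ⟶ b} {i j} {f g : (𝟙 a ≫ F).entry i j →ₗ[ℂ] M}
    (h : ∀ x, f (gen (𝟙 a) F j x (unitVec a j)) = g (gen (𝟙 a) F j x (unitVec a j))) : f = g :=
  ext_gen fun k x => ext_unit fun p => by subst p; exact h x

theorem ext_unit_left {F : a ⟶ b} {i j} {f g : (F ≫ 𝟙 b).entry i j →ₗ[ℂ] M}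
    (h : ∀ x, f (gen F (𝟙 b) i (unitVec b i) x) = g (gen F (𝟙 b) i (unitVec b i) x)) : f = g :=
  ext_gen' fun k x => ext_unit fun p => by subst p; exact h x

end ext

/-- The left whiskering `F ◁ η`, entrywise `⨁ₖ η i k ⊗ id`. -/
noncomputable def whiskerL (F : a ⟶ b) {G H : b ⟶ c} (η : G ⟶ H) : F ≫ G ⟶ F ≫ H :=
  ⟨fun i _ => descGen fun k => gen F H k ∘ₗ η.app i k⟩

@[simp] theorem whiskerL_gen (F : a ⟶ b) {G H : b ⟶ c} (η : G ⟶ H) (i) (j) (k)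
    (y : G.entry i k) (x : F.entry k j) :
    (whiskerL F η).app i j (gen F G k y x) = gen F H k (η.app i k y) x :=
  descGen_gen _ _ _ _

/-- The right whiskering `η ▷ H`, entrywise `⨁ₖ id ⊗ η k j`. -/
noncomputable def whiskerR {F G : a ⟶ b} (η : F ⟶ G) (H : b ⟶ c) : F ≫ H ⟶ G ≫ H :=
  ⟨fun _ j => descGen fun k => (gen G H k).compl₂ (η.app k j)⟩

@[simp] theorem whiskerR_gen {F G : a ⟶ b} (η : F ⟶ G) (H : b ⟶ c) (i) (j) (k)
    (y : H.entry i k) (x : F.entry k j) :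
    (whiskerR η H).app i j (gen F H k y x) = gen G H k y (η.app k j x) :=
  descGen_gen _ _ _ _

/-- The associator distributes tensor products over direct sums and reassociates:
`h ⊗ (g ⊗ f) ↦ (h ⊗ g) ⊗ f`. -/
noncomputable def assocHom (F : a ⟶ b) (G : b ⟶ c) (H : c ⟶ d) : (F ≫ G) ≫ H ⟶ F ≫ G ≫ H :=
  ⟨fun i j => desc fun l => descLeft fun k =>
    incl (X := fun k => tensor ((G ≫ H).entry i k) (F.entry k j)) k ∘ₗ
    tmap (incl (X := fun l => tensor (H.entry i l) (G.entry l k)) l) LinearMap.id ∘ₗ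
    tassocInv (H.entry i l) (G.entry l k) (F.entry k j)⟩

@[simp] theorem assocHom_gen (F : a ⟶ b) (G : b ⟶ c) (H : c ⟶ d) (i) (j) (k) (l)
    (h : H.entry i l) (g : G.entry l k) (f : F.entry k j) :
    (assocHom F G H).app i j (gen (F ≫ G) H l h (gen F G k g f)) =
      gen F (G ≫ H) k (gen G H l h g) f :=
  (desc_incl (X := fun l => tensor (H.entry i l) ((F ≫ G).entry l j)) _ l _).trans
    (descLeft_incl (X := fun k => tensor (G.entry l k) (F.entry k j)) _ k _ _)

/-- The inverse associator, `(h ⊗ g) ⊗ f ↦ h ⊗ (g ⊗ f)`. -/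
noncomputable def assocInv (F : a ⟶ b) (G : b ⟶ c) (H : c ⟶ d) : F ≫ G ≫ H ⟶ (F ≫ G) ≫ H :=
  ⟨fun i j => desc fun k => descRight fun l =>
    incl (X := fun l => tensor (H.entry i l) ((F ≫ G).entry l j)) l ∘ₗ
    tmap LinearMap.id (incl (X := fun k => tensor (G.entry l k) (F.entry k j)) k) ∘ₗ
    tassoc (H.entry i l) (G.entry l k) (F.entry k j)⟩

@[simp] theorem assocInv_gen (F : a ⟶ b) (G : b ⟶ c) (H : c ⟶ d) (i) (j) (k) (l)
    (h : H.entry i l) (g : G.entry l k) (f : F.entry k j) :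
    (assocInv F G H).app i j (gen F (G ≫ H) k (gen G H l h g) f) =
      gen (F ≫ G) H l h (gen F G k g f) :=
  (desc_incl (X := fun k => tensor ((G ≫ H).entry i k) (F.entry k j)) _ k _).trans
    (descRight_incl (X := fun l => tensor (H.entry i l) (G.entry l k)) _ l _ _)

noncomputable def assoc (F : a ⟶ b) (G : b ⟶ c) (H : c ⟶ d) : (F ≫ G) ≫ H ≅ F ≫ G ≫ H where
  hom := assocHom F G H
  inv := assocInv F G H
  hom_inv_id := hom_ext fun i j => ext_gen fun l h => ext_gen fun k g => LinearMap.ext fun f => by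
    simp
  inv_hom_id := hom_ext fun i j => ext_gen' fun k f => ext_gen fun l h => LinearMap.ext fun g => by
    simp

/-- The left unitor, `f ⊗ 1 ↦ f`. -/
noncomputable def leftUnitHom (F : a ⟶ b) : 𝟙 a ≫ F ⟶ F :=
  ⟨fun i j => tlift (LinearMap.lsmul ℂ (F.entry i j) ∘ₗ coord (i := j) rfl).flip ∘ₗ
    proj (X := fun k => tensor (F.entry i k) (delta k j)) j⟩

@[simp] theorem leftUnitHom_gen (F : a ⟶ b) (i) (j) (x : F.entry i j) :
    (leftUnitHom F).app i j (gen (𝟙 a) F j x (unitVec a j)) = x := by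
  refine (congrArg (tlift _) (proj_incl_same
    (X := fun k => tensor (F.entry i k) (delta k j)) j _)).trans ?_
  refine (tlift_tmul _ _ _).trans ?_
  simp [unitVec]

/-- The right unitor, `1 ⊗ f ↦ f`. -/
noncomputable def rightUnitHom (F : a ⟶ b) : F ≫ 𝟙 b ⟶ F :=
  ⟨fun i j => tlift (LinearMap.lsmul ℂ (F.entry i j) ∘ₗ coord (i := i) rfl) ∘ₗ
    proj (X := fun k => tensor (delta i k) (F.entry k j)) i⟩

@[simp] theorem rightUnitHom_gen (F : a ⟶ b) (i) (j) (x : F.entry i j) :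
    (rightUnitHom F).app i j (gen F (𝟙 b) i (unitVec b i) x) = x := by
  refine (congrArg (tlift _) (proj_incl_same
    (X := fun k => tensor (delta i k) (F.entry k j)) i _)).trans ?_
  refine (tlift_tmul _ _ _).trans ?_
  simp [unitVec]

noncomputable def leftUnit (F : a ⟶ b) : 𝟙 a ≫ F ≅ F where
  hom := leftUnitHom F
  inv := ⟨fun _ j => (gen (𝟙 a) F j).flip (unitVec a j)⟩
  hom_inv_id := hom_ext fun i j => ext_unit_right fun x => by simp
  inv_hom_id := hom_ext fun i j => LinearMap.ext fun x => by simp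

noncomputable def rightUnit (F : a ⟶ b) : F ≫ 𝟙 b ≅ F where
  hom := rightUnitHom F
  inv := ⟨fun i _ => gen F (𝟙 b) i (unitVec b i)⟩
  hom_inv_id := hom_ext fun i j => ext_unit_left fun x => by simp
  inv_hom_id := hom_ext fun i j => LinearMap.ext fun x => by simp

end

/-- `2Hilb` as a (weak) 2-category. -/
noncomputable instance : Bicategory TwoHilb where
  whiskerLeft := whiskerL
  whiskerRight := whiskerR
  associator := assoc
  leftUnitor := leftUnit
  rightUnitor := rightUnit
  whiskerLeft_id F G := by
    refine hom_ext fun i j => ext_gen fun k y => LinearMap.ext fun x => ?_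
    simp
  whiskerLeft_comp F _ _ _ η θ := by
    refine hom_ext fun i j => ext_gen fun k y => LinearMap.ext fun x => ?_
    simp
  id_whiskerLeft η := by
    refine hom_ext fun i j => ext_unit_right fun x => ?_
    simp [leftUnit]
  comp_whiskerLeft F G _ _ η := by
    refine hom_ext fun i j => ext_gen fun l h => ext_gen fun k g => LinearMap.ext fun f => ?_
    simp [assoc]
  id_whiskerRight F G := by
    refine hom_ext fun i j => ext_gen fun k y => LinearMap.ext fun x => ?_
    simp
  comp_whiskerRight η θ G := by
    refine hom_ext fun i j => ext_gen fun k y => LinearMap.ext fun x => ?_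
    simp
  whiskerRight_id η := by
    refine hom_ext fun i j => ext_unit_left fun x => ?_
    simp [rightUnit]
  whiskerRight_comp η G H := by
    refine hom_ext fun i j => ext_gen' fun k f => ext_gen fun l h => LinearMap.ext fun g => ?_
    simp [assoc]
  whisker_assoc F _ _ η H := by
    refine hom_ext fun i j => ext_gen fun l h => ext_gen fun k g => LinearMap.ext fun f => ?_
    simp [assoc]
  whisker_exchange η θ := by
    refine hom_ext fun i j => ext_gen fun k y => LinearMap.ext fun x => ?_
    simp
  pentagon F G H I := by
    refine hom_ext fun i j => ext_gen fun l h => ext_gen fun k g => ext_gen fun m e => LinearMap.ext fun f => ?_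
    simp [assoc]
  triangle F G := by
    refine hom_ext fun i j => ext_gen fun k y => ext_unit_left fun x => ?_
    simp [assoc, leftUnit, rightUnit]

/-! ### The symmetric monoidal category of scalars -/

/-- The monoidal unit object `Hilb` of `2Hilb`. -/
abbrev hilb : TwoHilb := ⟨1⟩

/-- The crossing of two scalars `X, Y : Hilb ⟶ Hilb`: the symmetry `y ⊗ x ↦ x ⊗ y` of the tensor
product of Hilbert spaces. -/
noncomputable def crossing (X Y : hilb ⟶ hilb) : X ≫ Y ⟶ Y ≫ X :=
  ⟨fun i j => match i, j with
    | 0, 0 => descGen fun k => match k with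
      | 0 => (gen Y X 0).flip⟩

theorem crossing_gen (X Y : hilb ⟶ hilb) (y : Y.entry 0 0) (x : X.entry 0 0) :
    (crossing X Y).app 0 0 (gen X Y 0 y x) = gen Y X 0 x y :=
  descGen_gen _ _ _ _

theorem scalar_ext {X Y : hilb ⟶ hilb} {η θ : X ⟶ Y} (h : η.app 0 0 = θ.app 0 0) : η = θ :=
  hom_ext fun i j => by
    obtain rfl : i = 0 := Subsingleton.elim _ _
    obtain rfl : j = 0 := Subsingleton.elim _ _
    exact h

theorem scalar_ext_gen {M : Type*} [AddCommMonoid M] [Module ℂ M] {X Y : hilb ⟶ hilb}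
    {f g : (X ≫ Y).entry 0 0 →ₗ[ℂ] M} (h : ∀ y, f ∘ₗ gen X Y 0 y = g ∘ₗ gen X Y 0 y) : f = g :=
  ext_gen fun k => by
    obtain rfl : k = 0 := Subsingleton.elim _ _
    exact h

theorem scalar_ext_gen' {M : Type*} [AddCommMonoid M] [Module ℂ M] {X Y : hilb ⟶ hilb}
    {f g : (X ≫ Y).entry 0 0 →ₗ[ℂ] M}
    (h : ∀ x, f ∘ₗ (gen X Y 0).flip x = g ∘ₗ (gen X Y 0).flip x) : f = g :=
  ext_gen' fun k => by
    obtain rfl : k = 0 := Subsingleton.elim _ _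
    exact h

theorem crossing_crossing (X Y : hilb ⟶ hilb) : crossing X Y ≫ crossing Y X = 𝟙 (X ≫ Y) := by
  refine scalar_ext (scalar_ext_gen fun y => LinearMap.ext fun x => ?_)
  simp [crossing_gen]

section

open Bicategory

variable {a b c d : TwoHilb}

theorem whiskerLeft_gen (F : a ⟶ b) {G H : b ⟶ c} (η : G ⟶ H) (i) (j) (k)
    (y : G.entry i k) (x : F.entry k j) :
    (F ◁ η).app i j (gen F G k y x) = gen F H k (η.app i k y) x := whiskerL_gen F η i j k y x

theorem whiskerRight_gen {F G : a ⟶ b} (η : F ⟶ G) (H : b ⟶ c) (i) (j) (k)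
    (y : H.entry i k) (x : F.entry k j) :
    (η ▷ H).app i j (gen F H k y x) = gen G H k y (η.app k j x) := whiskerR_gen η H i j k y x

theorem associator_hom_gen (F : a ⟶ b) (G : b ⟶ c) (H : c ⟶ d) (i) (j) (k) (l)
    (h : H.entry i l) (g : G.entry l k) (f : F.entry k j) :
    (α_ F G H).hom.app i j (gen (F ≫ G) H l h (gen F G k g f)) =
      gen F (G ≫ H) k (gen G H l h g) f := assocHom_gen F G H i j k l h g f

theorem associator_inv_gen (F : a ⟶ b) (G : b ⟶ c) (H : c ⟶ d) (i) (j) (k) (l)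
    (h : H.entry i l) (g : G.entry l k) (f : F.entry k j) :
    (α_ F G H).inv.app i j (gen F (G ≫ H) k (gen G H l h g) f) =
      gen (F ≫ G) H l h (gen F G k g f) := assocInv_gen F G H i j k l h g f

theorem leftUnitor_hom_gen (F : a ⟶ b) (i) (j) (x : F.entry i j) :
    (λ_ F).hom.app i j (gen (𝟙 a) F j x (unitVec a j)) = x := leftUnitHom_gen F i j x

theorem rightUnitor_hom_gen (F : a ⟶ b) (i) (j) (x : F.entry i j) :
    (ρ_ F).hom.app i j (gen F (𝟙 b) i (unitVec b i) x) = x := rightUnitHom_gen F i j x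

end

/-- The scalars `Hilb ⟶ Hilb` form a symmetric monoidal category, with tensor product the
composition of 1-cells and symmetry the crossing. -/
noncomputable instance : SymmetricCategory (hilb ⟶ hilb) where
  braiding X Y := ⟨crossing X Y, crossing Y X, crossing_crossing X Y, crossing_crossing Y X⟩
  braiding_naturality_right X _ _ f := by
    refine scalar_ext (scalar_ext_gen fun y => LinearMap.ext fun x => ?_)
    simp [crossing_gen, whiskerLeft_gen, whiskerRight_gen]
  braiding_naturality_left f Z := by
    refine scalar_ext (scalar_ext_gen fun y => LinearMap.ext fun x => ?_)
    simp [crossing_gen, whiskerLeft_gen, whiskerRight_gen]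
  hexagon_forward X Y Z := by
    refine scalar_ext (scalar_ext_gen fun z => scalar_ext_gen fun y => LinearMap.ext fun x => ?_)
    simp [crossing_gen, whiskerLeft_gen, whiskerRight_gen, associator_hom_gen]
  hexagon_reverse X Y Z := by
    refine scalar_ext (scalar_ext_gen' fun x => scalar_ext_gen fun z => LinearMap.ext fun y => ?_)
    simp [crossing_gen, whiskerLeft_gen, whiskerRight_gen, associator_inv_gen]
  symmetry X Y := crossing_crossing X Y

/-! ### Reversal of 2-cells -/

section

variable {a b : TwoHilb}

/-- The reversal `η†` of a 2-cell: the matrix of adjoint linear maps. -/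
noncomputable def dagger {F G : a ⟶ b} (η : F ⟶ G) : G ⟶ F :=
  ⟨fun i j => LinearMap.adjoint (η.app i j)⟩

/-- A 2-cell is unitary if its reversal is its inverse. -/
def IsUnitary {F G : a ⟶ b} (η : F ⟶ G) : Prop := η ≫ dagger η = 𝟙 F ∧ dagger η ≫ η = 𝟙 G

end

/-! ### Witnesses -/

/-- The data of a candidate witness for `A`: the two 1-cells and the four 2-cells. -/
structure WitnessData (A : TwoHilb) where
  /-- the 1-cell `I ⟶ A` -/
  source : hilb ⟶ A
  /-- the 1-cell `A ⟶ I` -/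
  target : A ⟶ hilb
  create : 𝟙 hilb ⟶ source ≫ target
  delete : source ≫ target ⟶ 𝟙 hilb
  copy : 𝟙 A ⟶ target ≫ source
  compare : target ≫ source ⟶ 𝟙 A

namespace WitnessData

open Bicategory

variable {A : TwoHilb}

/-- Deletion and comparison are the reversals of creation and copying. -/
def IsReversal (W : WitnessData A) : Prop :=
  W.delete = dagger W.create ∧ W.compare = dagger W.copy

/-- The four straightening equations: the 1-cells are ambidextrous duals, with
`source ⊣ target` by creation and comparison, and `target ⊣ source` by copying and deletion. -/
def IsAmbidextrous (W : WitnessData A) : Prop :=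
  (λ_ W.source).inv ≫ W.create ▷ W.source ≫ (α_ _ _ _).hom ≫ W.source ◁ W.compare ≫
      (ρ_ W.source).hom = 𝟙 W.source ∧
  (ρ_ W.target).inv ≫ W.target ◁ W.create ≫ (α_ _ _ _).inv ≫ W.compare ▷ W.target ≫
      (λ_ W.target).hom = 𝟙 W.target ∧
  (λ_ W.target).inv ≫ W.copy ▷ W.target ≫ (α_ _ _ _).hom ≫ W.target ◁ W.delete ≫
      (ρ_ W.target).hom = 𝟙 W.target ∧
  (ρ_ W.source).inv ≫ W.source ◁ W.copy ≫ (α_ _ _ _).inv ≫ W.delete ▷ W.source ≫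
      (λ_ W.source).hom = 𝟙 W.source

/-- Copying followed by comparison is the identity. -/
def IsCopyCompare (W : WitnessData A) : Prop := W.copy ≫ W.compare = 𝟙 (𝟙 A)

/-- The scalar `I ⟶ A ⟶ I`. -/
noncomputable abbrev scalar (W : WitnessData A) : hilb ⟶ hilb := W.source ≫ W.target

/-- The multiplication on `I ⟶ A ⟶ I`: compare the two adjacent inner 1-cells. -/
noncomputable def mul (W : WitnessData A) : W.scalar ≫ W.scalar ⟶ W.scalar :=
  (α_ W.source W.target (W.source ≫ W.target)).hom ≫
    W.source ◁ ((α_ W.target W.source W.target).inv ≫ W.compare ▷ W.target ≫ (λ_ W.target).hom)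

/-- Commutativity: crossing two copies of `I ⟶ A ⟶ I` before comparing makes no difference. -/
def IsCommutative (W : WitnessData A) : Prop :=
  (BraidedCategory.braiding W.scalar W.scalar).hom ≫ W.mul = W.mul

/-- A witness for `A`. -/
structure IsWitness (W : WitnessData A) : Prop where
  reversal : W.IsReversal
  ambidextrous : W.IsAmbidextrous
  copyCompare : W.IsCopyCompare
  commutative : W.IsCommutative

/-- A unitary isomorphism of witnesses: unitary 2-cells between the respective 1-cells that
carry creation, deletion, copying and comparison to each other. -/
def UnitarilyIsomorphic (W W' : WitnessData A) : Prop :=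
  ∃ (u : W.source ⟶ W'.source) (v : W.target ⟶ W'.target), IsUnitary u ∧ IsUnitary v ∧
    W.create ≫ u ▷ W.target ≫ W'.source ◁ v = W'.create ∧
    u ▷ W.target ≫ W'.source ◁ v ≫ W'.delete = W.delete ∧
    W.copy ≫ v ▷ W.source ≫ W'.target ◁ u = W'.copy ∧
    v ▷ W.source ≫ W'.target ◁ u ≫ W'.compare = W.compare

end WitnessData

/-! ### The explicit witness -/

/-- The column matrix `(ℂ, …, ℂ)ᵀ : Hilb ⟶ Hilb^n`. -/
noncomputable def column (n : ℕ) : hilb ⟶ (⟨n⟩ : TwoHilb) := ⟨fun _ _ => complex⟩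

/-- The row matrix `(ℂ, …, ℂ) : Hilb^n ⟶ Hilb`. -/
noncomputable def row (n : ℕ) : (⟨n⟩ : TwoHilb) ⟶ hilb := ⟨fun _ _ => complex⟩

/-- Multiplication of complex numbers as a bilinear map. -/
noncomputable def complexMul : complex →ₗ[ℂ] complex →ₗ[ℂ] ℂ :=
  (LinearMap.mul ℂ ℂ).compl₁₂ toComplex toComplex

/-- The explicit witness for `Hilb^n`, up to the identification `ℂ ⊗ ℂ = ℂ`: copying and
comparison are the `n × n` matrices with entries `1` on the diagonal and `0` off it, creation is
the all-ones column `ℂ ⟶ ℂ^n` and deletion is the all-ones row `ℂ^n ⟶ ℂ`. -/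
noncomputable def standardWitness (n : ℕ) : WitnessData ⟨n⟩ where
  source := column n
  target := row n
  create := ⟨fun i j => LinearMap.toSpanSingleton ℂ _
    (∑ k, gen (column n) (row n) k complexOne complexOne) ∘ₗ coord (Subsingleton.elim i j)⟩
  delete := ⟨fun i j => descGen fun _ =>
    complexMul.compr₂ (LinearMap.toSpanSingleton ℂ _ (one (Subsingleton.elim i j)))⟩
  copy := ⟨fun i j => if h : i = j then LinearMap.toSpanSingleton ℂ _
    (gen (row n) (column n) 0 complexOne complexOne) ∘ₗ coord h else 0⟩
  compare := ⟨fun i j => if h : i = j then descGen fun _ =>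
    complexMul.compr₂ (LinearMap.toSpanSingleton ℂ _ (one h)) else 0⟩

end TwoHilb

/-! Off the diagonal an identity 1-cell is zero, so comparison amounts to bilinear pairings β_i :
L_i × R_i → ℂ (`comparePairing`). On elementary tensors from the same summand, commutativity reads
β(x', y) y' ⊗ x = β(x, y') y ⊗ x' (`IsCommutative.smul_gen`). If β(x, y) ≠ 0, then contracting this
identity shows that x spans L_i and y spans R_i. If β_i = 0, the straightening equations, which
recover each vector by contracting create(1) with β_i, force L_i = R_i = 0. This bounds the
dimensions by 1. The copy–compare law excludes β_i = 0, so the dimensions of a witness are exactly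
1.

For unit vectors x, y in one-dimensional entries write copy(1) = s x ⊗ y. Copy–compare gives s β(x,
y) = 1 and reversal gives β(x, y) = conj s, so |β(x, y)| = 1 (`norm_comparePairing`).

For uniqueness, absorb this phase into x_i, so that β_i(x_i, y_i) = 1 with both vectors of norm 1.
Then copy(1) = x_i ⊗ y_i by copy–compare, while straightening forces create(1) = ∑ y_k ⊗ x_k and
delete(y_i ⊗ x_i) = 1. These are the formulas of the standard witness, so x_i ↦ 1, y_i ↦ 1 is the
required unitary isomorphism. The standard witness itself is checked on elementary tensors. -/

open scoped InnerProductSpace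

/-! ### Inner products on tensor products, direct sums and lines -/

namespace FdHilb

section delta

variable {n : ℕ} {i j : Fin n}

theorem coord_smul_one (h : i = j) (z : delta i j) : coord h z • one h = z :=
  LinearMap.congr_fun (f := LinearMap.toSpanSingleton ℂ _ (one h) ∘ₗ coord h)
    (g := LinearMap.id) (delta_ext fun p => by simp) z

theorem delta_eq_zero (h : i ≠ j) (z : delta i j) : z = 0 :=
  LinearMap.congr_fun (f := LinearMap.id) (g := 0) (delta_ext fun p => absurd p h) z

end delta

theorem inner_tmul {X Y : FdHilb} (x x' : X) (y y' : Y) :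
    ⟪(tmul x y : tensor X Y), tmul x' y'⟫_ℂ = ⟪x, x'⟫_ℂ * ⟪y, y'⟫_ℂ :=
  TensorProduct.inner_tmul (𝕜 := ℂ) (E := X) (F := Y) x x' y y'

section dsum

variable {ι : Type} [Fintype ι] [DecidableEq ι] {X : ι → FdHilb}

theorem inner_incl (k : ι) (x : X k) (z : dsum X) :
    ⟪incl k x, z⟫_ℂ = ⟪x, proj k z⟫_ℂ := by
  refine (PiLp.inner_apply (𝕜 := ℂ) (f := fun k => (X k : Type)) (incl k x) z).trans ?_
  rw [Finset.sum_eq_single k]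
  · exact congrArg (⟪·, proj k z⟫_ℂ) (proj_incl_same k x)
  · intro l _ h
    exact (congrArg (⟪·, proj l z⟫_ℂ) (proj_incl_ne h x)).trans (inner_zero_left _)
  · simp

end dsum

theorem inner_complexOne : ⟪complexOne, complexOne⟫_ℂ = 1 := by
  refine (RCLike.inner_apply (𝕜 := ℂ) 1 1).trans (by simp)

theorem inner_one {n : ℕ} {i j : Fin n} (h : i = j) : ⟪one h, one h⟫_ℂ = 1 :=
  (inner_incl (X := fun _ : PLift (i = j) => complex) ⟨h⟩ complexOne _).trans <|
    (congrArg _ (proj_incl_same (X := fun _ : PLift (i = j) => complex) ⟨h⟩ complexOne)).trans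
      inner_complexOne

section line

variable {X : FdHilb}

/-- The linear map `ℂ → X` with value `e` at `1`. -/
noncomputable def ofLine (e : X) : complex →ₗ[ℂ] X := LinearMap.toSpanSingleton ℂ X e ∘ₗ toComplex

@[simp] theorem ofLine_one (e : X) : ofLine e complexOne = e := by simp [ofLine]

/-- The ket–bra duality: for a spanning unit vector e, this adjoint is the coordinate along e, from
which the unitary isomorphism is later built. -/
theorem adjoint_ofLine (e x : X) :
    LinearMap.adjoint (ofLine e) x = ⟪e, x⟫_ℂ • complexOne := by
  have h : ⟪complexOne, LinearMap.adjoint (ofLine e) x⟫_ℂ = ⟪e, x⟫_ℂ := by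
    rw [LinearMap.adjoint_inner_right, ofLine_one]
  rw [← h, ← toComplex_smul_one (LinearMap.adjoint (ofLine e) x), inner_smul_right,
    inner_complexOne, mul_one]

theorem eq_inner_smul {e : X} (he : ‖e‖ = 1) (h : ∀ x : X, ∃ c : ℂ, c • e = x) (x : X) :
    ⟪e, x⟫_ℂ • e = x := by
  obtain ⟨c, rfl⟩ := h x
  rw [inner_smul_right, inner_self_eq_norm_sq_to_K, he]
  simp

theorem exists_smul_eq (hX : Module.finrank ℂ X = 1) {e : X} (he : ‖e‖ = 1) (x : X) :
    ∃ c : ℂ, c • e = x :=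
  (finrank_eq_one_iff_of_nonzero' e (norm_ne_zero_iff.1 (by simp [he]))).1 hX x

theorem exists_norm_eq_one (hX : Module.finrank ℂ X = 1) : ∃ e : X, ‖e‖ = 1 := by
  have : Nontrivial X := Module.nontrivial_of_finrank_pos (R := ℂ) (by omega)
  obtain ⟨x, hx⟩ := exists_ne (0 : X)
  exact ⟨_, norm_smul_inv_norm (𝕜 := ℂ) hx⟩

end line

end FdHilb

/-! ### Elementary tensors in entries of composite 1-cells -/

namespace TwoHilb

variable {a b c : TwoHilb}

section gen

variable {F : a ⟶ b} {G : b ⟶ c} {i : Fin c.dim} {j : Fin a.dim}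

/-- The linear map out of an entry of a composite that is given on elementary tensors in the
`k`-th summand and vanishes on the other summands. -/
noncomputable def descAt {Y : FdHilb} (k) (f : G.entry i k →ₗ[ℂ] F.entry k j →ₗ[ℂ] Y) :
    (F ≫ G).entry i j →ₗ[ℂ] Y :=
  tlift f ∘ₗ proj (X := fun k => tensor (G.entry i k) (F.entry k j)) k

theorem descAt_gen_same {Y : FdHilb} (k) (f : G.entry i k →ₗ[ℂ] F.entry k j →ₗ[ℂ] Y)
    (y : G.entry i k) (x : F.entry k j) : descAt k f (gen F G k y x) = f y x :=
  (congrArg (tlift f) (proj_incl_same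
    (X := fun k => tensor (G.entry i k) (F.entry k j)) k _)).trans (tlift_tmul _ _ _)

theorem descAt_gen_ne {Y : FdHilb} {k l} (h : l ≠ k)
    (f : G.entry i k →ₗ[ℂ] F.entry k j →ₗ[ℂ] Y) (y : G.entry i l) (x : F.entry l j) :
    descAt k f (gen F G l y x) = 0 :=
  (congrArg (tlift f) (proj_incl_ne
    (X := fun k => tensor (G.entry i k) (F.entry k j)) h.symm _)).trans (map_zero _)

theorem inner_gen_same (k) (y y' : G.entry i k) (x x' : F.entry k j) :
    ⟪gen F G k y x, gen F G k y' x'⟫_ℂ = ⟪y, y'⟫_ℂ * ⟪x, x'⟫_ℂ :=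
  (inner_incl (X := fun k => tensor (G.entry i k) (F.entry k j)) k _ _).trans <|
    (congrArg _ (proj_incl_same (X := fun k => tensor (G.entry i k) (F.entry k j)) k _)).trans
      (inner_tmul _ _ _ _)

theorem inner_gen_ne {k l} (h : k ≠ l) (y : G.entry i k) (y' : G.entry i l)
    (x : F.entry k j) (x' : F.entry l j) : ⟪gen F G k y x, gen F G l y' x'⟫_ℂ = 0 :=
  (inner_incl (X := fun k => tensor (G.entry i k) (F.entry k j)) k _ _).trans <|
    (congrArg _ (proj_incl_ne (X := fun k => tensor (G.entry i k) (F.entry k j)) h _)).trans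
      (inner_zero_right _)

/-- When all factors are lines, the tensors e_k ⊗ f_k form an orthonormal basis of the entry, one
vector per summand. -/
theorem exists_eq_sum_gen {e : ∀ k, G.entry i k} {f : ∀ k, F.entry k j}
    (he : ∀ k, ‖e k‖ = 1) (hf : ∀ k, ‖f k‖ = 1)
    (hE : ∀ k, ∀ y : G.entry i k, ∃ c : ℂ, c • e k = y)
    (hF : ∀ k, ∀ x : F.entry k j, ∃ c : ℂ, c • f k = x)
    (z : (F ≫ G).entry i j) : ∃ c : Fin b.dim → ℂ, z = ∑ k, c k • gen F G k (e k) (f k) := by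
  refine ⟨fun k => ⟪gen F G k (e k) (f k), z⟫_ℂ, ?_⟩
  -- The resolution of the identity ∑ |e_k ⊗ f_k⟩⟨e_k ⊗ f_k|; being an equation of linear maps, it
  -- can be tested on elementary tensors.
  have key : LinearMap.id = ∑ k, LinearMap.toSpanSingleton ℂ _ (gen F G k (e k) (f k)) ∘ₗ
      (innerₛₗ ℂ (gen F G k (e k) (f k))) := by
    refine ext_gen fun k y => LinearMap.ext fun x => ?_
    simp only [LinearMap.comp_apply, LinearMap.sum_apply, LinearMap.toSpanSingleton_apply,
      innerₛₗ_apply_apply, LinearMap.id_apply]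
    rw [Finset.sum_eq_single k]
    · rw [inner_gen_same, mul_smul, ← map_smul, eq_inner_smul (hf k) (hF k), ← LinearMap.smul_apply,
        ← map_smul, eq_inner_smul (he k) (hE k)]
    · intro l _ h
      rw [inner_gen_ne h, zero_smul]
    · simp
  refine (LinearMap.congr_fun key z).trans ?_
  simp

end gen

end TwoHilb

/-! ### The witness axioms in terms of pairings -/

namespace TwoHilb

variable {a b c : TwoHilb}

open Bicategory

theorem coord_smul_unitVec {i : Fin a.dim} (z : OneCell.entry (𝟙 a) i i) :
    coord rfl z • unitVec a i = z := coord_smul_one rfl z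

theorem id_entry_eq_zero {i j : Fin a.dim} (h : i ≠ j) (z : OneCell.entry (𝟙 a) i j) : z = 0 :=
  delta_eq_zero h z

theorem coord_unitVec (i : Fin a.dim) : coord rfl (unitVec a i) = 1 := coord_one rfl

theorem leftUnitor_inv_apply (F : a ⟶ b) (i) (j) (x : F.entry i j) :
    (λ_ F).inv.app i j x = gen (𝟙 a) F j x (unitVec a j) := rfl

theorem rightUnitor_inv_apply (F : a ⟶ b) (i) (j) (x : F.entry i j) :
    (ρ_ F).inv.app i j x = gen F (𝟙 b) i (unitVec b i) x := rfl

namespace WitnessData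

variable {A : TwoHilb} (W : WitnessData A) (i : Fin A.dim)

/-- The bilinear form on the `i`-th entries of the 1-cells given by comparison. -/
noncomputable def comparePairing :
    W.source.entry i 0 →ₗ[ℂ] W.target.entry 0 i →ₗ[ℂ] ℂ :=
  (gen W.target W.source (i := i) (j := i) 0).compr₂ (coord (i := i) rfl ∘ₗ W.compare.app i i)

/-- The bilinear form on the `i`-th entries of the 1-cells given by deletion. -/
noncomputable def deletePairing :
    W.target.entry 0 i →ₗ[ℂ] W.source.entry i 0 →ₗ[ℂ] ℂ :=
  (gen W.source W.target (i := 0) (j := 0) i).compr₂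
    (coord (i := (0 : Fin hilb.dim)) rfl ∘ₗ W.delete.app 0 0)

variable {i}

theorem compare_gen (x : W.source.entry i 0) (y : W.target.entry 0 i) :
    W.compare.app i i (gen W.target W.source 0 x y) = W.comparePairing i x y • unitVec A i :=
  (coord_smul_unitVec _).symm

theorem compare_eq_zero {j : Fin A.dim} (h : i ≠ j) (z) : W.compare.app i j z = 0 :=
  id_entry_eq_zero h _

theorem delete_gen (y : W.target.entry 0 i) (x : W.source.entry i 0) :
    W.delete.app 0 0 (gen W.source W.target i y x) = W.deletePairing i y x • unitVec hilb 0 :=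
  (coord_smul_unitVec _).symm

variable {W}

/-- The first straightening equation in coordinates: comparison vanishes off the diagonal, so only
the i-th summand of create(1) survives, contracted with β_i(x, ·). -/
theorem IsAmbidextrous.create_source (hW : W.IsAmbidextrous) (x : W.source.entry i 0) :
    descAt i ((W.comparePairing i x).smulRight LinearMap.id)
      (W.create.app 0 0 (unitVec hilb 0)) = x := by
  have h := LinearMap.congr_fun (congrArg (fun η => TwoCell.app η i 0) hW.1) x
  simp only [comp_app, LinearMap.comp_apply, id_app, LinearMap.id_apply, leftUnitor_inv_apply,
    whiskerRight_gen] at h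
  -- No formula for create(1) is available, so the remainder of the composite is treated as a linear
  -- map in that vector and compared with the contraction on elementary tensors.
  refine Eq.trans (LinearMap.congr_fun (g := (ρ_ W.source).hom.app i 0 ∘ₗ
    (W.source ◁ W.compare).app i 0 ∘ₗ (α_ W.source W.target W.source).hom.app i 0 ∘ₗ
    gen (W.source ≫ W.target) W.source 0 x) ?_ _) h
  refine ext_gen fun k y => LinearMap.ext fun x' => ?_
  simp only [LinearMap.comp_apply, associator_hom_gen, whiskerLeft_gen]
  obtain rfl | hk := eq_or_ne k i
  · rw [descAt_gen_same, compare_gen, map_smul, LinearMap.smul_apply, map_smul,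
      rightUnitor_hom_gen]
    rfl
  · rw [descAt_gen_ne hk, compare_eq_zero _ hk.symm]
    simp

theorem IsAmbidextrous.create_target (hW : W.IsAmbidextrous) (y : W.target.entry 0 i) :
    descAt i (((W.comparePairing i).flip y).smulRight LinearMap.id).flip
      (W.create.app 0 0 (unitVec hilb 0)) = y := by
  have h := LinearMap.congr_fun (congrArg (fun η => TwoCell.app η 0 i) hW.2.1) y
  simp only [comp_app, LinearMap.comp_apply, id_app, LinearMap.id_apply, rightUnitor_inv_apply,
    whiskerLeft_gen] at h
  refine Eq.trans (LinearMap.congr_fun (g := (λ_ W.target).hom.app 0 i ∘ₗ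
    (W.compare ▷ W.target).app 0 i ∘ₗ (α_ W.target W.source W.target).inv.app 0 i ∘ₗ
    (gen W.target (W.source ≫ W.target) 0).flip y) ?_ _) h
  refine ext_gen fun k y' => LinearMap.ext fun x => ?_
  simp only [LinearMap.comp_apply, LinearMap.flip_apply, associator_inv_gen, whiskerRight_gen]
  obtain rfl | hk := eq_or_ne k i
  · rw [descAt_gen_same, compare_gen, map_smul, map_smul, leftUnitor_hom_gen]
    rfl
  · rw [descAt_gen_ne hk, compare_eq_zero _ hk]
    simp

/-- Here deletion contracts copy(1). The middle object is `hilb`, so there is a single summand and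
no off-diagonal case. -/
theorem IsAmbidextrous.delete_target (hW : W.IsAmbidextrous) (y : W.target.entry 0 i) :
    descAt 0 ((W.deletePairing i y).smulRight LinearMap.id)
      (W.copy.app i i (unitVec A i)) = y := by
  have h := LinearMap.congr_fun (congrArg (fun η => TwoCell.app η 0 i) hW.2.2.1) y
  simp only [comp_app, LinearMap.comp_apply, id_app, LinearMap.id_apply, leftUnitor_inv_apply,
    whiskerRight_gen] at h
  refine Eq.trans (LinearMap.congr_fun (g := (ρ_ W.target).hom.app 0 i ∘ₗ
    (W.target ◁ W.delete).app 0 i ∘ₗ (α_ W.target W.source W.target).hom.app 0 i ∘ₗ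
    gen (W.target ≫ W.source) W.target i y) ?_ _) h
  refine ext_gen fun k x => LinearMap.ext fun y' => ?_
  obtain rfl : k = 0 := Subsingleton.elim _ _
  simp only [LinearMap.comp_apply, associator_hom_gen, whiskerLeft_gen]
  rw [descAt_gen_same, delete_gen, map_smul, LinearMap.smul_apply, map_smul,
      rightUnitor_hom_gen]
  rfl

theorem mul_gen_same (y y' : W.target.entry 0 i) (x x' : W.source.entry i 0) :
    W.mul.app 0 0 (gen W.scalar W.scalar 0 (gen W.source W.target i y x)
      (gen W.source W.target i y' x')) =
      W.comparePairing i x y' • gen W.source W.target i y x' := by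
  simp only [mul, comp_app, LinearMap.comp_apply, associator_hom_gen, whiskerLeft_gen,
    associator_inv_gen, whiskerRight_gen, compare_gen, map_smul, leftUnitor_hom_gen,
    LinearMap.smul_apply]

theorem mul_gen_ne {j : Fin A.dim} (h : i ≠ j) (y : W.target.entry 0 i) (y' : W.target.entry 0 j)
    (x : W.source.entry i 0) (x' : W.source.entry j 0) :
    W.mul.app 0 0 (gen W.scalar W.scalar 0 (gen W.source W.target i y x)
      (gen W.source W.target j y' x')) = 0 := by
  simp only [mul, comp_app, LinearMap.comp_apply, associator_hom_gen, whiskerLeft_gen,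
    associator_inv_gen, whiskerRight_gen, compare_eq_zero _ h, map_zero, LinearMap.zero_apply]

/-- The multiplication pairs the two inner vectors and keeps the two outer ones; crossing the
factors exchanges which are inner and which are outer. -/
theorem IsCommutative.smul_gen (hW : W.IsCommutative) (y y' : W.target.entry 0 i)
    (x x' : W.source.entry i 0) :
    W.comparePairing i x' y • gen W.source W.target (i := 0) (j := 0) i y' x =
      W.comparePairing i x y' • gen W.source W.target i y x' := by
  rw [← mul_gen_same, ← mul_gen_same, ← crossing_gen]
  exact LinearMap.congr_fun (congrArg (fun η => TwoCell.app η 0 0) hW) _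

theorem IsCommutative.smul_target (hW : W.IsCommutative) (y y' : W.target.entry 0 i)
    (x : W.source.entry i 0) (h : W.comparePairing i x y' ≠ 0) : ∃ c : ℂ, c • y' = y := by
  -- Taking both source vectors equal to x and contracting them against y' turns the identity of
  -- tensors into β(x, y) y' = β(x, y') y, up to the nonzero factor β(x, y').
  have key := congrArg (descAt i (((W.comparePairing i).flip y').smulRight LinearMap.id).flip)
    (hW.smul_gen y y' x x)
  simp only [map_smul, descAt_gen_same, LinearMap.flip_apply, LinearMap.smulRight_apply,
    LinearMap.smul_apply, LinearMap.id_apply] at key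
  rw [smul_comm] at key
  refine ⟨(W.comparePairing i x y')⁻¹ * W.comparePairing i x y, ?_⟩
  rw [mul_smul, smul_right_injective _ h key, inv_smul_smul₀ h]

theorem IsCommutative.smul_source (hW : W.IsCommutative) (x x' : W.source.entry i 0)
    (y : W.target.entry 0 i) (h : W.comparePairing i x y ≠ 0) : ∃ c : ℂ, c • x = x' := by
  have key := congrArg (descAt i ((W.comparePairing i x).smulRight LinearMap.id))
    (hW.smul_gen y y x x')
  simp only [map_smul, descAt_gen_same, LinearMap.smulRight_apply,
    LinearMap.smul_apply, LinearMap.id_apply] at key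
  rw [smul_comm] at key
  refine ⟨(W.comparePairing i x y)⁻¹ * W.comparePairing i x' y, ?_⟩
  rw [mul_smul, smul_right_injective _ h key, inv_smul_smul₀ h]

/-! ### Dimensions of the entries and modulus of the comparison scalar -/

theorem finrank_source_le_one (hW : W.IsAmbidextrous) (hW' : W.IsCommutative) (i : Fin A.dim) :
    Module.finrank ℂ (W.source.entry i 0) ≤ 1 := by
  by_cases h : ∃ x y, W.comparePairing i x y ≠ 0
  · obtain ⟨x, y, h⟩ := h
    exact finrank_le_one x fun x' => hW'.smul_source x x' y h
  · push Not at h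
    -- With β_i = 0, straightening expresses x as a contraction with the zero form, so x = 0 and the
    -- zero vector spans.
    refine finrank_le_one 0 fun x => ⟨0, ?_⟩
    rw [← hW.create_source x, (LinearMap.ext (h x) : W.comparePairing i x = 0)]
    refine (smul_zero _).trans (LinearMap.congr_fun (f := 0) (ext_gen fun k y =>
      LinearMap.ext fun x' => ?_) _)
    obtain rfl | hk := eq_or_ne k i
    · simp [descAt_gen_same]
    · simp [descAt_gen_ne hk]

theorem finrank_target_le_one (hW : W.IsAmbidextrous) (hW' : W.IsCommutative) (i : Fin A.dim) :
    Module.finrank ℂ (W.target.entry 0 i) ≤ 1 := by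
  by_cases h : ∃ x y, W.comparePairing i x y ≠ 0
  · obtain ⟨x, y, h⟩ := h
    exact finrank_le_one y fun y' => hW'.smul_target y' y x h
  · push Not at h
    refine finrank_le_one 0 fun y => ⟨0, ?_⟩
    rw [← hW.create_target y,
      (LinearMap.ext (h · y) : (W.comparePairing i).flip y = 0)]
    refine (smul_zero _).trans (LinearMap.congr_fun (f := 0) (ext_gen fun k y =>
      LinearMap.ext fun x' => ?_) _)
    obtain rfl | hk := eq_or_ne k i
    · simp [descAt_gen_same]
    · simp [descAt_gen_ne hk]

/-- A zero pairing would make the composite of copy and compare zero at (i, i), where it must be the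
identity of a copy of ℂ. -/
theorem IsCopyCompare.exists_comparePairing_ne_zero (hW : W.IsCopyCompare) (i : Fin A.dim) :
    ∃ x y, W.comparePairing i x y ≠ 0 := by
  by_contra! h
  have h1 := LinearMap.congr_fun (congrArg (fun η => TwoCell.app η i i) hW) (unitVec A i)
  have h2 : W.compare.app i i = 0 := ext_gen fun k x => LinearMap.ext fun y => by
    obtain rfl : k = 0 := Subsingleton.elim _ _
    simp [compare_gen, h]
  simp only [comp_app, h2, LinearMap.zero_comp, LinearMap.zero_apply, id_app,
    LinearMap.id_apply] at h1
  have h3 := coord_unitVec i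
  rw [← h1, map_zero] at h3
  exact zero_ne_one h3

theorem IsWitness.finrank_eq_one (hW : W.IsWitness) (i : Fin A.dim) :
    Module.finrank ℂ (W.source.entry i 0) = 1 ∧ Module.finrank ℂ (W.target.entry 0 i) = 1 := by
  obtain ⟨x, y, h⟩ := hW.copyCompare.exists_comparePairing_ne_zero i
  have hx : x ≠ 0 := by rintro rfl; simp at h
  have hy : y ≠ 0 := by rintro rfl; simp at h
  exact ⟨_root_.finrank_eq_one x hx fun x' => hW.commutative.smul_source x x' y h,
    _root_.finrank_eq_one y hy fun y' => hW.commutative.smul_target y' y x h⟩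

theorem exists_copy_eq_smul {x : W.source.entry i 0} {y : W.target.entry 0 i}
    (hx : ‖x‖ = 1) (hy : ‖y‖ = 1) (hX : ∀ x', ∃ c : ℂ, c • x = x') (hY : ∀ y', ∃ c : ℂ, c • y = y') :
    ∃ s : ℂ, W.copy.app i i (unitVec A i) = s • gen W.target W.source 0 x y := by
  have e : ∀ k : Fin hilb.dim, k = 0 := fun k => Subsingleton.elim _ _
  -- The middle index lies in a one-element type, but the basis must be a family over all k, so x
  -- and y are transported along k = 0.
  obtain ⟨c, hc⟩ := exists_eq_sum_gen (e := fun k => (e k).symm ▸ x) (f := fun k => (e k).symm ▸ y)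
    (fun k => by obtain rfl := e k; exact hx) (fun k => by obtain rfl := e k; exact hy)
    (fun k => by obtain rfl := e k; exact hX) (fun k => by obtain rfl := e k; exact hY)
    (W.copy.app i i (unitVec A i))
  exact ⟨c 0, hc.trans (Fin.sum_univ_one _)⟩

theorem IsCopyCompare.mul_comparePairing (hW : W.IsCopyCompare) {x : W.source.entry i 0}
    {y : W.target.entry 0 i} {s : ℂ}
    (hs : W.copy.app i i (unitVec A i) = s • gen W.target W.source 0 x y) :
    s * W.comparePairing i x y = 1 := by
  have h1 := LinearMap.congr_fun (congrArg (fun η => TwoCell.app η i i) hW) (unitVec A i)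
  simp only [comp_app, LinearMap.comp_apply, id_app, LinearMap.id_apply, hs, map_smul,
    compare_gen, smul_smul] at h1
  simpa [coord_unitVec] using congrArg (coord rfl) h1

theorem norm_comparePairing (hW : W.IsReversal) (hW' : W.IsCopyCompare)
    (hX : Module.finrank ℂ (W.source.entry i 0) = 1)
    (hY : Module.finrank ℂ (W.target.entry 0 i) = 1)
    {x : W.source.entry i 0} {y : W.target.entry 0 i} (hx : ‖x‖ = 1) (hy : ‖y‖ = 1) :
    ‖W.comparePairing i x y‖ = 1 := by
  obtain ⟨s, hs⟩ := exists_copy_eq_smul hx hy (exists_smul_eq hX hx) (exists_smul_eq hY hy)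
  have h1 := hW'.mul_comparePairing hs
  -- Reversal as an adjunction: the left side is β(x, y), and the right side is conj s, since the
  -- inner product is conjugate-linear in its first argument.
  have h2 : ⟪unitVec A i, W.compare.app i i (gen W.target W.source 0 x y)⟫_ℂ =
      ⟪W.copy.app i i (unitVec A i), gen W.target W.source 0 x y⟫_ℂ := by
    rw [hW.2]
    exact LinearMap.adjoint_inner_right _ _ _
  have h3 : ⟪unitVec A i, unitVec A i⟫_ℂ = 1 := inner_one rfl
  rw [compare_gen, hs, inner_smul_left, inner_smul_right, h3, inner_gen_same,
    inner_self_eq_norm_sq_to_K x, inner_self_eq_norm_sq_to_K y, hx, hy] at h2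
  have h4 : W.comparePairing i x y = (starRingEnd ℂ) s := by simpa using h2
  have h5 : ‖s‖ * ‖s‖ = 1 := by simpa [h4] using congrArg norm h1
  rw [h4, RCLike.norm_conj]
  nlinarith [norm_nonneg s]

end WitnessData

end TwoHilb

/-! ### Unitaries onto ℂ and values of the standard witness -/

namespace TwoHilb

open Bicategory

/-- A spanning unit vector in each entry makes 1 ↦ e an isometry of ℂ onto that entry, whose adjoint
is its inverse. -/
theorem IsUnitary.of_line {a b : TwoHilb} {F : a ⟶ b} {e : ∀ i j, F.entry i j}
    (he : ∀ i j, ‖e i j‖ = 1) (hF : ∀ i j, ∀ x : F.entry i j, ∃ c : ℂ, c • e i j = x) :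
    IsUnitary (F := F) (G := ⟨fun _ _ => complex⟩)
      ⟨fun i j => LinearMap.adjoint (ofLine (e i j))⟩ := by
  constructor
  · refine hom_ext fun i j => LinearMap.ext fun x => ?_
    simp only [comp_app, dagger, LinearMap.adjoint_adjoint, LinearMap.comp_apply, adjoint_ofLine,
      map_smul, ofLine_one]
    exact eq_inner_smul (he i j) (hF i j) x
  · refine hom_ext fun i j => complex_ext ?_
    simp only [comp_app, dagger, LinearMap.adjoint_adjoint, LinearMap.comp_apply, adjoint_ofLine,
      ofLine_one, inner_self_eq_norm_sq_to_K, he]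
    simp

theorem adjoint_ofLine_self {X : FdHilb} {e : X} (he : ‖e‖ = 1) :
    LinearMap.adjoint (ofLine e) e = complexOne := by
  rw [adjoint_ofLine, inner_self_eq_norm_sq_to_K, he]
  simp

theorem whisker_gen {a b c : TwoHilb} {F F' : a ⟶ b} {G G' : b ⟶ c} (u : F ⟶ F') (v : G ⟶ G')
    (i j k) (y : G.entry i k) (x : F.entry k j) :
    (F' ◁ v).app i j ((u ▷ G).app i j (gen F G k y x)) =
      gen F' G' k (v.app i k y) (u.app k j x) := by
  rw [whiskerRight_gen, whiskerLeft_gen]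

section standard

variable (n : ℕ)

theorem standardWitness_create :
    (standardWitness n).create.app 0 0 (unitVec hilb 0) =
      ∑ k, gen (column n) (row n) k complexOne complexOne := by
  refine (congrArg (LinearMap.toSpanSingleton ℂ _ _) (coord_unitVec (a := hilb) 0)).trans ?_
  exact one_smul _ _

variable {n}

theorem standardWitness_copy (i : Fin n) :
    (standardWitness n).copy.app i i (unitVec ⟨n⟩ i) =
      gen (row n) (column n) 0 complexOne complexOne := by
  have h : (standardWitness n).copy.app i i = LinearMap.toSpanSingleton ℂ _
    (gen (row n) (column n) 0 complexOne complexOne) ∘ₗ coord rfl := dif_pos rfl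
  rw [h]
  refine (congrArg (LinearMap.toSpanSingleton ℂ _ _) (coord_unitVec (a := ⟨n⟩) i)).trans ?_
  exact one_smul _ _

theorem standardWitness_compare (i : Fin n) (x y : complex) :
    (standardWitness n).compare.app i i (gen (row n) (column n) 0 x y) =
      (toComplex x * toComplex y) • unitVec ⟨n⟩ i := by
  have h : (standardWitness n).compare.app i i = descGen fun _ =>
    complexMul.compr₂ (LinearMap.toSpanSingleton ℂ _ (one rfl)) := dif_pos rfl
  rw [h]
  exact descGen_gen _ _ _ _

theorem standardWitness_delete (k : Fin n) (x y : complex) :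
    (standardWitness n).delete.app 0 0 (gen (column n) (row n) k x y) =
      (toComplex x * toComplex y) • unitVec hilb 0 :=
  descGen_gen _ _ _ _

theorem standardWitness_comparePairing (i : Fin n) (x y : complex) :
    (standardWitness n).comparePairing i x y = toComplex x * toComplex y := by
  refine (congrArg (coord rfl) (standardWitness_compare i x y)).trans ?_
  rw [map_smul, coord_unitVec, smul_eq_mul, mul_one]

theorem standardWitness_deletePairing (i : Fin n) (x y : complex) :
    (standardWitness n).deletePairing i x y = toComplex x * toComplex y := by
  refine (congrArg (coord rfl) (standardWitness_delete i x y)).trans ?_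
  rw [map_smul, coord_unitVec, smul_eq_mul, mul_one]

theorem gen_column_row (k : Fin n) (y x : complex) :
    gen (column n) (row n) (i := 0) (j := 0) k y x =
      (toComplex y * toComplex x) • gen (column n) (row n) k complexOne complexOne := by
  conv_lhs => rw [← toComplex_smul_one x, ← toComplex_smul_one y]
  rw [mul_comm, mul_smul]
  refine (map_smul (gen (column n) (row n) (i := 0) (j := 0) k _) _ _).trans (congrArg _ ?_)
  exact LinearMap.map_smul₂ (gen (column n) (row n) (i := 0) (j := 0) k) _ _ _

theorem smul_smul_gen_column_row (k : Fin n) (x x' y y' : complex) :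
    (toComplex x' * toComplex y) • (toComplex y' * toComplex x) •
      gen (column n) (row n) (i := 0) (j := 0) k complexOne complexOne =
    (toComplex x * toComplex y') • (toComplex y * toComplex x') •
      gen (column n) (row n) k complexOne complexOne := by
  rw [smul_smul, smul_smul]
  congr 1
  ring

end standard

/-! ### The standard witness satisfies the axioms -/

namespace WitnessData

theorem standardWitness_isReversal (n : ℕ) : (standardWitness n).IsReversal := by
  constructor
  -- Taking adjoints is involutive, so the adjoint may be moved onto delete; both maps then start
  -- from a line and need comparing only at 1.
  · suffices h : (standardWitness n).create.app 0 0 =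
        LinearMap.adjoint ((standardWitness n).delete.app 0 0) by
      refine scalar_ext ?_
      change _ = LinearMap.adjoint ((standardWitness n).create.app 0 0)
      rw [h, LinearMap.adjoint_adjoint]
    refine ext_unit fun _ => ext_inner_right ℂ fun v => ?_
    rw [LinearMap.adjoint_inner_left]
    -- Both inner products are linear in v, so v may be taken to be an elementary tensor.
    refine LinearMap.congr_fun (f := innerₛₗ ℂ _) (g := innerₛₗ ℂ _ ∘ₗ
      (standardWitness n).delete.app 0 0) (ext_gen fun k y => LinearMap.ext fun x => ?_) v
    simp only [LinearMap.comp_apply, innerₛₗ_apply_apply]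
    rw [standardWitness_create]
    refine (congrArg (⟪_, ·⟫_ℂ) (gen_column_row k y x)).trans ?_
    refine Eq.trans ?_ (congrArg (⟪_, ·⟫_ℂ) (standardWitness_delete k y x)).symm
    rw [inner_smul_right, inner_smul_right, sum_inner, Finset.sum_eq_single k]
    · refine congrArg _ ?_
      refine ((inner_gen_same k _ _ _ _).trans ?_).trans (inner_one rfl).symm
      exact (congrArg₂ _ inner_complexOne inner_complexOne).trans (one_mul 1)
    · exact fun l _ h => inner_gen_ne h _ _ _ _
    · simp
  · refine hom_ext fun i j => ?_
    obtain rfl | hij := eq_or_ne i j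
    · suffices h : (standardWitness n).copy.app i i =
          LinearMap.adjoint ((standardWitness n).compare.app i i) by
        change _ = LinearMap.adjoint ((standardWitness n).copy.app i i)
        rw [h, LinearMap.adjoint_adjoint]
      refine ext_unit fun _ => ext_inner_right ℂ fun v => ?_
      rw [LinearMap.adjoint_inner_left]
      refine LinearMap.congr_fun (f := innerₛₗ ℂ _) (g := innerₛₗ ℂ _ ∘ₗ
        (standardWitness n).compare.app i i) (ext_gen fun k x => LinearMap.ext fun y => ?_) v
      obtain rfl : k = 0 := Subsingleton.elim _ _
      simp only [LinearMap.comp_apply, innerₛₗ_apply_apply]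
      rw [standardWitness_copy]
      refine Eq.trans ?_ (congrArg (⟪_, ·⟫_ℂ) (standardWitness_compare i x y)).symm
      refine (inner_gen_same (F := row n) (G := column n) 0 _ _ _ _).trans ?_
      rw [inner_smul_right]
      refine Eq.trans ?_ (congrArg _ (inner_one rfl).symm)
      have h (z : complex) : ⟪complexOne, z⟫_ℂ = toComplex z := by
        conv_lhs => rw [← toComplex_smul_one z]
        rw [inner_smul_right, inner_complexOne, mul_one]
      exact (congrArg₂ _ (h x) (h y)).trans (mul_one _).symm
    · have h : (standardWitness n).copy.app i j = 0 := dif_neg hij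
      change _ = LinearMap.adjoint ((standardWitness n).copy.app i j)
      rw [h, map_zero]
      exact dif_neg hij

/-- Because x_i and y_i span, each straightening equation needs checking only at these vectors,
where the sum for create collapses to its i-th term. -/
theorem IsAmbidextrous.of_eq_sum {A : TwoHilb} {W : WitnessData A}
    {x : ∀ i, W.source.entry i 0} {y : ∀ i, W.target.entry 0 i}
    (hX : ∀ i, ∀ x', ∃ c : ℂ, c • x i = x') (hY : ∀ i, ∀ y', ∃ c : ℂ, c • y i = y')
    (hcreate : W.create.app 0 0 (unitVec hilb 0) = ∑ k, gen W.source W.target k (y k) (x k))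
    (hcopy : ∀ i, W.copy.app i i (unitVec A i) = gen W.target W.source 0 (x i) (y i))
    (hcompare : ∀ i, W.comparePairing i (x i) (y i) = 1)
    (hdelete : ∀ i, W.deletePairing i (y i) (x i) = 1) : W.IsAmbidextrous := by
  have extX {i : Fin A.dim} {M : FdHilb} {f g : W.source.entry i 0 →ₗ[ℂ] M}
      (h : f (x i) = g (x i)) : f = g := LinearMap.ext fun x' => by
    obtain ⟨c, rfl⟩ := hX i x'
    rw [map_smul, map_smul, h]
  have extY {i : Fin A.dim} {M : FdHilb} {f g : W.target.entry 0 i →ₗ[ℂ] M}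
      (h : f (y i) = g (y i)) : f = g := LinearMap.ext fun y' => by
    obtain ⟨c, rfl⟩ := hY i y'
    rw [map_smul, map_smul, h]
  refine ⟨?_, ?_, ?_, ?_⟩
  · refine hom_ext fun i j => ?_
    obtain rfl : j = 0 := Subsingleton.elim _ _
    refine extX ?_
    simp only [comp_app, LinearMap.comp_apply, leftUnitor_inv_apply, whiskerRight_gen, hcreate,
      map_sum, associator_hom_gen, whiskerLeft_gen, id_app, LinearMap.id_apply]
    rw [Finset.sum_eq_single i]
    · rw [compare_gen, hcompare, one_smul, rightUnitor_hom_gen]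
    · intro k _ h
      rw [compare_eq_zero _ h.symm, map_zero, LinearMap.zero_apply, map_zero]
    · simp
  · refine hom_ext fun j i => ?_
    obtain rfl : j = 0 := Subsingleton.elim _ _
    refine extY ?_
    simp only [comp_app, LinearMap.comp_apply, rightUnitor_inv_apply, whiskerLeft_gen, hcreate,
      map_sum, LinearMap.sum_apply, associator_inv_gen, whiskerRight_gen, id_app,
      LinearMap.id_apply]
    rw [Finset.sum_eq_single i]
    · rw [compare_gen, hcompare, one_smul, leftUnitor_hom_gen]
    · intro k _ h
      rw [compare_eq_zero _ h, map_zero, map_zero]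
    · simp
  · refine hom_ext fun j i => ?_
    obtain rfl : j = 0 := Subsingleton.elim _ _
    refine extY ?_
    simp only [comp_app, LinearMap.comp_apply, leftUnitor_inv_apply, whiskerRight_gen, hcopy,
      associator_hom_gen, whiskerLeft_gen, delete_gen, hdelete, one_smul, rightUnitor_hom_gen,
      id_app, LinearMap.id_apply]
  · refine hom_ext fun i j => ?_
    obtain rfl : j = 0 := Subsingleton.elim _ _
    refine extX ?_
    simp only [comp_app, LinearMap.comp_apply, rightUnitor_inv_apply, whiskerLeft_gen, hcopy,
      associator_inv_gen, whiskerRight_gen, delete_gen, hdelete, one_smul, leftUnitor_hom_gen,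
      id_app, LinearMap.id_apply]

theorem standardWitness_isAmbidextrous (n : ℕ) : (standardWitness n).IsAmbidextrous :=
  .of_eq_sum (x := fun _ => complexOne) (y := fun _ => complexOne)
    (fun _ x => ⟨toComplex x, toComplex_smul_one x⟩)
    (fun _ x => ⟨toComplex x, toComplex_smul_one x⟩)
    (standardWitness_create n) standardWitness_copy
    (fun i => (standardWitness_comparePairing i _ _).trans (by simp))
    (fun i => (standardWitness_deletePairing i _ _).trans (by simp))

theorem standardWitness_isCopyCompare (n : ℕ) : (standardWitness n).IsCopyCompare := by
  refine hom_ext fun i j => ext_unit fun p => ?_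
  obtain rfl := p
  simp only [comp_app, LinearMap.comp_apply, standardWitness_copy]
  refine (standardWitness_compare i _ _).trans ?_
  simp

/-- The multiplication is the pointwise product on ℂ^n: different summands multiply to zero, and
within a summand commutativity is that of ℂ. -/
theorem standardWitness_isCommutative (n : ℕ) : (standardWitness n).IsCommutative := by
  refine scalar_ext (scalar_ext_gen' fun z => ext_gen fun k y => LinearMap.ext fun x => ?_)
  -- With the left factor already elementary, the right factor z is reduced to elementary tensors by
  -- linearity.
  refine LinearMap.congr_fun
    (f := TwoCell.app (_ ≫ (standardWitness n).mul) 0 0 ∘ₗ gen _ _ 0 (gen _ _ k y x))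
    (g := (standardWitness n).mul.app 0 0 ∘ₗ gen _ _ 0 (gen _ _ k y x))
    (ext_gen fun l y' => LinearMap.ext fun x' => ?_) z
  simp only [LinearMap.comp_apply, comp_app]
  refine (congrArg _ (crossing_gen _ _ _ _)).trans ?_
  obtain rfl | h := eq_or_ne k l
  · rw [mul_gen_same, mul_gen_same]
    refine (congrArg₂ _ (standardWitness_comparePairing k _ _) (gen_column_row k _ _)).trans
      (Eq.trans ?_ (congrArg₂ _ (standardWitness_comparePairing k _ _) (gen_column_row k _ _)).symm)
    exact smul_smul_gen_column_row k x x' y y'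
  · rw [mul_gen_ne h, mul_gen_ne h.symm]

theorem standardWitness_isWitness (n : ℕ) : (standardWitness n).IsWitness :=
  ⟨standardWitness_isReversal n, standardWitness_isAmbidextrous n,
    standardWitness_isCopyCompare n, standardWitness_isCommutative n⟩

/-! ### Uniqueness up to unitary isomorphism -/

variable {A : TwoHilb} {W : WitnessData A}

theorem IsWitness.exists_comparePairing_eq_one (hW : W.IsWitness) (i : Fin A.dim) :
    ∃ (x : W.source.entry i 0) (y : W.target.entry 0 i), ‖x‖ = 1 ∧ ‖y‖ = 1 ∧
      W.comparePairing i x y = 1 := by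
  obtain ⟨hX, hY⟩ := hW.finrank_eq_one i
  obtain ⟨x, hx⟩ := exists_norm_eq_one hX
  obtain ⟨y, hy⟩ := exists_norm_eq_one hY
  have h := norm_comparePairing hW.reversal hW.copyCompare hX hY hx hy
  -- The pairing of two unit vectors is a phase, so dividing x by it keeps the norm equal to 1.
  refine ⟨(W.comparePairing i x y)⁻¹ • x, y, ?_, hy, ?_⟩
  · rw [norm_smul, norm_inv, h, hx, inv_one, one_mul]
  · rw [map_smul, LinearMap.smul_apply, smul_eq_mul, inv_mul_cancel₀]
    exact norm_ne_zero_iff.1 (by rw [h]; exact one_ne_zero)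

/-- Expand create(1) in the basis y_k ⊗ x_k; straightening at x_k yields c_k x_k = x_k, so every
coefficient is 1. -/
theorem IsAmbidextrous.create_eq_sum (hW : W.IsAmbidextrous)
    {x : ∀ i, W.source.entry i 0} {y : ∀ i, W.target.entry 0 i}
    (hx : ∀ i, ‖x i‖ = 1) (hy : ∀ i, ‖y i‖ = 1)
    (hX : ∀ i, ∀ x', ∃ c : ℂ, c • x i = x') (hY : ∀ i, ∀ y', ∃ c : ℂ, c • y i = y')
    (h : ∀ i, W.comparePairing i (x i) (y i) = 1) :
    W.create.app 0 0 (unitVec hilb 0) = ∑ k, gen W.source W.target k (y k) (x k) := by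
  obtain ⟨c, hc⟩ := exists_eq_sum_gen hy hx hY hX (W.create.app 0 0 (unitVec hilb 0))
  rw [hc]
  refine Finset.sum_congr rfl fun k _ => ?_
  have h1 := hW.create_source (x k)
  rw [hc, map_sum, Finset.sum_eq_single k] at h1
  · rw [map_smul, descAt_gen_same] at h1
    simp only [LinearMap.smulRight_apply, h, one_smul, LinearMap.id_apply] at h1
    have hxk : x k ≠ 0 := norm_ne_zero_iff.1 (by rw [hx]; exact one_ne_zero)
    rw [smul_left_injective ℂ hxk (h1.trans (one_smul ℂ _).symm), one_smul]
  · intro l _ hl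
    rw [map_smul, descAt_gen_ne hl, smul_zero]
  · simp

theorem IsAmbidextrous.deletePairing_eq_one (hW : W.IsAmbidextrous) {i : Fin A.dim}
    {x : W.source.entry i 0} {y : W.target.entry 0 i} (hy : y ≠ 0)
    (h : W.copy.app i i (unitVec A i) = gen W.target W.source 0 x y) :
    W.deletePairing i y x = 1 := by
  have h1 := hW.delete_target y
  rw [h, descAt_gen_same] at h1
  exact smul_left_injective ℂ hy (h1.trans (one_smul ℂ _).symm)

theorem IsWitness.unitarilyIsomorphic {n : ℕ} {W : WitnessData ⟨n⟩} (hW : W.IsWitness) :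
    W.UnitarilyIsomorphic (standardWitness n) := by
  choose x y hx hy hxy using hW.exists_comparePairing_eq_one
  have hX i := exists_smul_eq (hW.finrank_eq_one i).1 (hx i)
  have hY i := exists_smul_eq (hW.finrank_eq_one i).2 (hy i)
  have hcreate := hW.ambidextrous.create_eq_sum hx hy hX hY hxy
  have hcopy i : W.copy.app i i (unitVec ⟨n⟩ i) = gen W.target W.source 0 (x i) (y i) := by
    obtain ⟨s, hs⟩ := exists_copy_eq_smul (hx i) (hy i) (hX i) (hY i)
    have h := hW.copyCompare.mul_comparePairing hs
    rw [hxy, mul_one] at h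
    rw [hs, h, one_smul]
  have hdelete i : W.deletePairing i (y i) (x i) = 1 :=
    hW.ambidextrous.deletePairing_eq_one
      (norm_ne_zero_iff.1 (by rw [hy]; exact one_ne_zero)) (hcopy i)
  let e : ∀ i j, W.source.entry i j := fun i j => match j with | 0 => x i
  let f : ∀ i j, W.target.entry i j := fun i j => match i with | 0 => y j
  -- Adjoints of 1 ↦ x_i and of 1 ↦ y_i: these send the normalized vectors to 1.
  let u : W.source ⟶ (standardWitness n).source :=
    ⟨fun i j => LinearMap.adjoint (ofLine (e i j))⟩
  let v : W.target ⟶ (standardWitness n).target :=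
    ⟨fun i j => LinearMap.adjoint (ofLine (f i j))⟩
  have hu i : u.app i 0 (x i) = complexOne := adjoint_ofLine_self (hx i)
  have hv i : v.app 0 i (y i) = complexOne := adjoint_ofLine_self (hy i)
  have hST k : ((standardWitness n).source ◁ v).app 0 0 ((u ▷ W.target).app 0 0
      (gen W.source W.target k (y k) (x k))) =
      gen (column n) (row n) k complexOne complexOne :=
    (whisker_gen _ _ _ _ _ _ _).trans
      (congrArg₂ (fun a b => gen (column n) (row n) k a b) (hv k) (hu k))
  have hTS i : ((standardWitness n).target ◁ u).app i i ((v ▷ W.source).app i i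
      (gen W.target W.source 0 (x i) (y i))) =
      gen (row n) (column n) 0 complexOne complexOne :=
    (whisker_gen _ _ _ _ _ _ _).trans
      (congrArg₂ (fun a b => gen (row n) (column n) 0 a b) (hu i) (hv i))
  have e0 : ∀ j : Fin hilb.dim, j = 0 := fun j => Subsingleton.elim _ _
  refine ⟨u, v, IsUnitary.of_line (e := e) (fun i j => ?_) (fun i j => ?_),
    IsUnitary.of_line (e := f) (fun i j => ?_) (fun i j => ?_), ?_, ?_, ?_, ?_⟩
  · obtain rfl := e0 j; exact hx i
  · obtain rfl := e0 j; exact hX i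
  · obtain rfl := e0 i; exact hy j
  · obtain rfl := e0 i; exact hY j
  · refine scalar_ext (ext_unit fun _ => ?_)
    refine Eq.trans ?_ (standardWitness_create n).symm
    simp only [comp_app, LinearMap.comp_apply, hcreate, map_sum]
    exact Finset.sum_congr rfl fun k _ => hST k
  · refine scalar_ext (ext_gen fun k y' => LinearMap.ext fun x' => ?_)
    obtain ⟨c, rfl⟩ := hX k x'
    obtain ⟨d, rfl⟩ := hY k y'
    simp only [comp_app, LinearMap.comp_apply, map_smul, LinearMap.smul_apply, delete_gen, hdelete]
    congr 2
    refine (congrArg _ (hST k)).trans ((standardWitness_delete k _ _).trans ?_)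
    simp
  · refine hom_ext fun i j => ext_unit fun p => ?_
    obtain rfl := p
    refine Eq.trans ?_ (standardWitness_copy i).symm
    simp only [comp_app, LinearMap.comp_apply, hcopy]
    exact hTS i
  · refine hom_ext fun i j => ?_
    obtain rfl | hij := eq_or_ne i j
    · refine ext_gen fun k x' => LinearMap.ext fun y' => ?_
      obtain rfl := e0 k
      obtain ⟨c, rfl⟩ := hX i x'
      obtain ⟨d, rfl⟩ := hY i y'
      simp only [comp_app, LinearMap.comp_apply, map_smul, LinearMap.smul_apply, compare_gen, hxy]
      congr 2
      refine (congrArg _ (hTS i)).trans ((standardWitness_compare i _ _).trans ?_)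
      simp
    -- Off the diagonal both composites land in the zero space.
    · exact LinearMap.ext fun z => (id_entry_eq_zero hij _).trans (id_entry_eq_zero hij _).symm

end WitnessData

end TwoHilb

theorem mainTheorem4 (n : ℕ) :
    (TwoHilb.standardWitness n).IsWitness ∧
    (∀ W : TwoHilb.WitnessData ⟨n⟩, W.IsWitness →
      W.UnitarilyIsomorphic (TwoHilb.standardWitness n)) ∧
    (∀ W : TwoHilb.WitnessData ⟨n⟩, W.IsAmbidextrous → W.IsCommutative → ∀ i : Fin n,
      Module.finrank ℂ (W.source.entry i 0) ≤ 1 ∧ Module.finrank ℂ (W.target.entry 0 i) ≤ 1) ∧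
    (∀ W : TwoHilb.WitnessData ⟨n⟩, W.IsWitness → ∀ i : Fin n,
      Module.finrank ℂ (W.source.entry i 0) = 1 ∧ Module.finrank ℂ (W.target.entry 0 i) = 1) ∧
    (∀ W : TwoHilb.WitnessData ⟨n⟩, W.IsReversal → W.IsCopyCompare → ∀ i : Fin n,
      Module.finrank ℂ (W.source.entry i 0) = 1 → Module.finrank ℂ (W.target.entry 0 i) = 1 →
      ∀ (x : W.source.entry i 0) (y : W.target.entry 0 i), ‖x‖ = 1 → ‖y‖ = 1 →
        ‖FdHilb.coord rfl (W.compare.app i i (TwoHilb.gen W.target W.source 0 x y))‖ = 1) := by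
  refine ⟨TwoHilb.WitnessData.standardWitness_isWitness n, fun W hW => hW.unitarilyIsomorphic,
    fun W hW hW' i => ⟨TwoHilb.WitnessData.finrank_source_le_one hW hW' i,
      TwoHilb.WitnessData.finrank_target_le_one hW hW' i⟩, fun W hW i => hW.finrank_eq_one i,
    fun W hW hW' i hX hY x y hx hy => ?_⟩
  -- `comparePairing` unfolds to the coordinate of comparison appearing in the goal.
  exact TwoHilb.WitnessData.norm_comparePairing hW hW' hX hY hx hy
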